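/- Write $\mathbb R_+=[0,\infty)$ and $\overline{\mathbb R}_+=[0,\infty]$, both with the Scott topology. For a topological space $X$, a continuous valuation on $X$ is a map $\mu$ from the open subsets of $X$ to $\overline{\mathbb R}_+$ that is strict ($\mu(\emptyset)=0$), monotone, modular ($\mu(U)+\mu(V)=\mu(U\cup V)+\mu(U\cap V)$) and satisfies $\mu(\bigcup_i U_i)=\sup_i\mu(U_i)$ for every directed family $(U_i)_i$. $\mathcal V_wX$ is the set of continuous valuations on $X$ with the weak topology, generated by the sets $[U>r]=\{\mu\mid\mu(U)>r\}$ ($U$ open, $r\in\mathbb R_+$). For lower semicontinuous $h\colon X\to\overline{\mathbb R}_+$ put $\int h\,d\mu=\int_0^\infty\mu(h^{-1}((r,\infty]))\,dr$. On the category $\mathbf{TOP}_0$ of $T_0$ spaces and continuous maps, $\mathcal V_w$ is a monad with $\mathcal V_wf(\mu)(V)=\mu(f^{-1}(V))$, unit $x\mapsto\delta_x$ (Dirac mass) and multiplication $m_X(\varpi)(U)=\int\mu(U)\,d\varpi(\mu)$. A cone is a commutative monoid $C$ with a scalar multiplication by $\mathbb R_+$ satisfying the usual module axioms. It is a semitopological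 (resp. topological) cone if it carries a $T_0$ topology making $+\colon C\times C\to C$ and $\cdot\colon\mathbb R_+\times C\to C$ separately (resp. jointly) continuous. It is weakly locally convex if every open neighbourhood of every point contains a convex (not necessarily open) neighbourhood of that point. A barycentre of a continuous valuation $\nu$ on $C$ is a point $b\in C$ such that $\Lambda(b)=\int\Lambda\,d\nu$ for every lower semicontinuous linear map $\Lambda\colon C\to\overline{\mathbb R}_+$. **Proposition.** Let $C$ be a semitopological cone and $\alpha\colon\mathcal V_wC\to C$ a continuous map such that, for every $\nu\in\mathcal V_wC$, $\alpha(\nu)$ is the unique barycentre of $\nu$. Then: 1. $(C,\alpha)$ is an (Eilenberg–Moore) algebra of the monad $\mathcal V_w$ on $\mathbf{TOP}_0$; 2. the cone structure induced by this algebra is the original one: $\alpha(\delta_x+\delta_y)=x+y$ and $\alpha(r\delta_x)=r\cdot x$ for all $x,y\in C$ and $r\in\mathbb R_+$; 3. $C$ is a sober, weakly locally convex, topological cone. -/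

import Mathlib

open scoped NNReal ENNReal
open TopologicalSpace MeasureTheory Set

universe u

/-- A continuous valuation on a topological space. -/
@[ext]
structure ContinuousValuation (X : Type u) [TopologicalSpace X] where
  toFun : Opens X → ℝ≥0∞
  map_bot' : toFun ⊥ = 0
  mono' : ∀ U V : Opens X, U ≤ V → toFun U ≤ toFun V
  modular' : ∀ U V : Opens X, toFun U + toFun V = toFun (U ⊔ V) + toFun (U ⊓ V)
  map_sSup' : ∀ S : Set (Opens X), S.Nonempty → DirectedOn (· ≤ ·) S →
    toFun (sSup S) = ⨆ U ∈ S, toFun U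

/-- Lower semicontinuous functions from `X` to `[0, ∞]`, that is, functions that are continuous
for the Scott topology on `[0, ∞]`. -/
structure LSC (X : Type u) [TopologicalSpace X] where
  toFun : X → ℝ≥0∞
  lsc : LowerSemicontinuous toFun

namespace LSC

variable {X Y : Type u} [TopologicalSpace X] [TopologicalSpace Y]

instance : CoeFun (LSC X) (fun _ => X → ℝ≥0∞) := ⟨LSC.toFun⟩

theorem ext_fun {f g : LSC X} (h : ∀ x, f x = g x) : f = g := by
  cases f; cases g; congr; funext x; exact h x

/-- The open set `h⁻¹ (r, ∞]`. -/
def level (h : LSC X) (r : ℝ≥0∞) : Opens X := ⟨h ⁻¹' Ioi r, h.lsc.isOpen_preimage r⟩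

theorem mem_level {h : LSC X} {r : ℝ≥0∞} {x : X} : x ∈ h.level r ↔ r < h x := Iff.rfl

/-- Composition of a lower semicontinuous function with a continuous map. -/
def comp (h : LSC Y) (f : C(X, Y)) : LSC X := ⟨h ∘ f, h.lsc.comp f.continuous⟩

/-- The pointwise sum. -/
noncomputable def add (f g : LSC X) : LSC X := ⟨fun x => f x + g x, f.lsc.add g.lsc⟩

/-- The pointwise scalar multiple. -/
noncomputable def smul (c : ℝ≥0) (f : LSC X) : LSC X :=
  ⟨fun x => c * f x, (ENNReal.continuous_const_mul ENNReal.coe_ne_top).comp_lowerSemicontinuous f.lsc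
    fun _ _ h => mul_le_mul_right h _⟩

/-- The function `c · χ_U`. -/
noncomputable def step (c : ℝ≥0) (U : Opens X) : LSC X :=
  ⟨indicator (U : Set X) fun _ => (c : ℝ≥0∞), U.isOpen.lowerSemicontinuous_indicator (by simp)⟩

/-- Adding the step functions `c · χ_{U 0}, …, c · χ_{U (n - 1)}` to `f`. -/
noncomputable def addSteps (f : LSC X) (c : ℝ≥0) (U : ℕ → Opens X) : ℕ → LSC X
  | 0 => f
  | n + 1 => (addSteps f c U n).add (step c (U n))

/-- The zero function. -/
noncomputable def zero : LSC X := ⟨fun _ => 0, lowerSemicontinuous_const⟩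

theorem addSteps_apply (f : LSC X) (c : ℝ≥0) (U : ℕ → Opens X) (n : ℕ) (x : X) :
    addSteps f c U n x = f x + ∑ k ∈ Finset.range n, step c (U k) x := by
  induction n with
  | zero => simp [addSteps]
  | succ n ih =>
    rw [Finset.sum_range_succ, ← add_assoc, ← ih]
    rfl

end LSC

namespace ContinuousValuation

variable {X Y : Type u} [TopologicalSpace X] [TopologicalSpace Y]

instance : CoeFun (ContinuousValuation X) (fun _ => Opens X → ℝ≥0∞) :=
  ⟨ContinuousValuation.toFun⟩

theorem ext_apply {μ ν : ContinuousValuation X} (h : ∀ U, μ U = ν U) : μ = ν :=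
  ContinuousValuation.ext (funext h)

theorem mono (μ : ContinuousValuation X) {U V : Opens X} (h : U ≤ V) : μ U ≤ μ V :=
  μ.mono' U V h

theorem map_iSup_directed (μ : ContinuousValuation X) {ι : Type*} [Nonempty ι] (U : ι → Opens X)
    (hU : Directed (· ≤ ·) U) : μ (⨆ i, U i) = ⨆ i, μ (U i) := by
  have h := μ.map_sSup' (range U) (range_nonempty U) (by
    rintro _ ⟨i, rfl⟩ _ ⟨j, rfl⟩
    obtain ⟨k, hik, hjk⟩ := hU i j
    exact ⟨_, mem_range_self k, hik, hjk⟩)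
  rw [sSup_range] at h
  rw [h, iSup_range]

/-- The integral `∫ h dμ = ∫₀^∞ μ (h⁻¹ (r, ∞]) dr`. The integrand is antitone in `r`, so its
Lebesgue integral is its improper Riemann integral. -/
noncomputable def integral (μ : ContinuousValuation X) (h : LSC X) : ℝ≥0∞ :=
  ∫⁻ r in Ioi (0 : ℝ), μ (h.level (ENNReal.ofReal r))

theorem antitone_level (μ : ContinuousValuation X) (h : LSC X) :
    Antitone fun r : ℝ => μ (h.level (ENNReal.ofReal r)) := by
  intro r s hrs
  exact μ.mono fun x hx => lt_of_le_of_lt (ENNReal.ofReal_le_ofReal hrs) hx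

theorem integral_mono (μ : ContinuousValuation X) {f g : LSC X} (h : ∀ x, f x ≤ g x) :
    μ.integral f ≤ μ.integral g :=
  lintegral_mono fun _ => μ.mono fun x hx => lt_of_lt_of_le hx (h x)

theorem integral_iSup_nat (μ : ContinuousValuation X) (f : ℕ → LSC X) (g : LSC X)
    (hf : ∀ x, Monotone fun n => f n x) (hg : ∀ x, g x = ⨆ n, f n x) :
    μ.integral g = ⨆ n, μ.integral (f n) := by
  unfold integral
  rw [← lintegral_iSup]
  · refine lintegral_congr fun r => ?_
    rw [← map_iSup_directed]
    · congr 1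
      ext x
      simp only [SetLike.mem_coe, Opens.mem_iSup, LSC.mem_level, hg, lt_iSup_iff]
    · refine Monotone.directed_le ?_
      intro n m hnm x hx
      exact lt_of_lt_of_le hx (hf x hnm)
  · intro n
    exact (μ.antitone_level (f n)).measurable
  · intro n m hnm r
    exact μ.mono fun x hx => lt_of_lt_of_le hx (hf x hnm)

theorem integral_add_step (μ : ContinuousValuation X) (h : LSC X) (c : ℝ≥0) (U : Opens X) :
    μ.integral (h.add (LSC.step c U)) = μ.integral h + c * μ U := by
  classical
  -- `L s` is the set `{h > s}`, read as everything when `s < 0`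
  let L : ℝ → Opens X := fun s => if s < 0 then ⊤ else h.level (ENNReal.ofReal s)
  have hLanti : Antitone L := by
    intro s t hst
    by_cases hs : s < 0
    · simp [L, hs]
    · have ht : ¬ t < 0 := fun h => hs (lt_of_le_of_lt hst h)
      simp only [L, hs, ht, if_false]
      intro x hx
      exact lt_of_le_of_lt (ENNReal.ofReal_le_ofReal hst) hx
  let H : ℝ → ℝ≥0∞ := fun s => μ (L s ⊓ U)
  have hHanti : Antitone H := fun s t hst => μ.mono (inf_le_inf_right U (hLanti hst))
  have hH : Measurable H := hHanti.measurable
  let J : ℝ≥0∞ := ∫⁻ s in Ioi (0 : ℝ), H s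
  have hshift : ∫⁻ r in Ioi (0 : ℝ), H (r - c) = c * μ U + J := by
    have h1 : ∫⁻ r in Ioi (0 : ℝ), H (r - c) = ∫⁻ s in Ioi (-(c : ℝ)), H s := by
      have := (measurePreserving_sub_right (volume : Measure ℝ) (c : ℝ)).setLIntegral_comp_preimage
        (s := Ioi (-(c : ℝ))) measurableSet_Ioi hH
      rw [← this]
      congr 2
      ext r
      simp
    have h2 : Ioi (-(c : ℝ)) = Ioc (-(c : ℝ)) 0 ∪ Ioi 0 := by
      rw [Ioc_union_Ioi_eq_Ioi]; simp
    rw [h1, h2, lintegral_union measurableSet_Ioi (by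
      rw [Set.disjoint_left]; intro x hx hx'; exact absurd hx.2 (not_le.2 hx'))]
    congr 1
    rw [← setLIntegral_congr (Ioo_ae_eq_Ioc (μ := volume) (a := -(c : ℝ)) (b := 0))]
    have h3 : ∫⁻ s in Ioo (-(c : ℝ)) 0, H s = ∫⁻ s in Ioo (-(c : ℝ)) 0, μ U := by
      refine setLIntegral_congr_fun measurableSet_Ioo fun s hs => ?_
      simp [H, L, hs.2]
    rw [h3, setLIntegral_const, Real.volume_Ioo, mul_comm]
    simp
  have hmod : ∀ r ∈ Ioi (0 : ℝ),
      μ ((h.add (LSC.step c U)).level (ENNReal.ofReal r)) + H r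
        = μ (h.level (ENNReal.ofReal r)) + H (r - c) := by
    intro r hr
    have hr0 : ¬ r < 0 := not_lt.2 (le_of_lt hr)
    have hLr : L r = h.level (ENNReal.ofReal r) := by simp [L, hr0]
    have hle : L r ≤ L (r - c) := hLanti (by simp)
    have hunion : (h.add (LSC.step c U)).level (ENNReal.ofReal r) = L r ⊔ (L (r - c) ⊓ U) := by
      ext x
      have hx1 : x ∈ (h.add (LSC.step c U)).level (ENNReal.ofReal r) ↔
        ENNReal.ofReal r < h x + indicator (U : Set X) (fun _ => (c : ℝ≥0∞)) x := Iff.rfl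
      simp only [SetLike.mem_coe, Opens.coe_sup, Opens.coe_inf, mem_union, mem_inter_iff]
      rw [hx1, hLr, LSC.mem_level]
      by_cases hxU : x ∈ U
      · have hxU' : x ∈ (U : Set X) := hxU
        rw [indicator_of_mem hxU']
        by_cases hrc : r - c < 0
        · have : ENNReal.ofReal r < h x + c := by
            refine lt_of_lt_of_le ?_ le_add_self
            rw [← ENNReal.ofReal_coe_nnreal]
            exact (ENNReal.ofReal_lt_ofReal_iff_of_nonneg (le_of_lt hr)).2 (by linarith)
          simp [L, hrc, hxU, this]
        · have hL : x ∈ L (r - c) ↔ ENNReal.ofReal r < h x + c := by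
            simp only [L, hrc, if_false, LSC.mem_level]
            rw [ENNReal.ofReal_sub _ c.coe_nonneg, ENNReal.ofReal_coe_nnreal]
            have hcr : (c : ℝ≥0∞) ≤ ENNReal.ofReal r := by
              rw [← ENNReal.ofReal_coe_nnreal]
              exact ENNReal.ofReal_le_ofReal (by linarith)
            conv_rhs => rw [← tsub_add_cancel_of_le hcr]
            exact (ENNReal.add_lt_add_iff_right ENNReal.coe_ne_top).symm
          rw [hL]
          constructor
          · intro h'
            exact Or.inr ⟨h', hxU⟩
          · rintro (h' | ⟨h', _⟩)
            · exact lt_of_lt_of_le h' le_self_add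
            · exact h'
      · have hxU' : x ∉ (U : Set X) := hxU
        rw [indicator_of_notMem hxU']
        simp [hxU]
    have hinter : L r ⊓ (L (r - c) ⊓ U) = L r ⊓ U := by
      rw [← inf_assoc, inf_eq_left.2 hle]
    rw [hunion, ← hLr]
    have := μ.modular' (L r) (L (r - c) ⊓ U)
    rw [hinter] at this
    exact this.symm
  have hsum : μ.integral (h.add (LSC.step c U)) + J = μ.integral h + c * μ U + J := by
    have := setLIntegral_congr_fun (μ := volume) (measurableSet_Ioi (a := (0 : ℝ))) hmod
    rw [lintegral_add_right _ hH, lintegral_add_left (μ.antitone_level h).measurable,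
      hshift] at this
    unfold integral
    rw [this, add_assoc]
  have hJ : J ≤ μ.integral h := by
    refine setLIntegral_mono' measurableSet_Ioi fun r hr => ?_
    have hr0 : ¬ r < 0 := not_lt.2 (le_of_lt hr)
    refine μ.mono (inf_le_left.trans ?_)
    simp [L, hr0]
  by_cases hJt : J = ∞
  · have h1 : μ.integral h = ∞ := top_le_iff.1 (hJt ▸ hJ)
    have h2 : μ.integral h ≤ μ.integral (h.add (LSC.step c U)) :=
      μ.integral_mono fun x => le_self_add
    rw [h1, top_add, top_le_iff.1 (h1.symm.le.trans h2)]
  · exact (ENNReal.add_left_inj hJt).1 hsum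

theorem integral_addSteps (μ : ContinuousValuation X) (f : LSC X) (c : ℝ≥0) (U : ℕ → Opens X)
    (n : ℕ) :
    μ.integral (f.addSteps c U n) = μ.integral f + ∑ k ∈ Finset.range n, c * μ (U k) := by
  induction n with
  | zero => simp [LSC.addSteps]
  | succ n ih => rw [LSC.addSteps, integral_add_step, ih, Finset.sum_range_succ, add_assoc]

theorem integral_zero (μ : ContinuousValuation X) : μ.integral LSC.zero = 0 := by
  unfold integral
  have : ∀ r : ℝ, (LSC.zero : LSC X).level (ENNReal.ofReal r) = ⊥ := by
    intro r
    rw [eq_bot_iff]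
    intro x hx
    exact absurd (LSC.mem_level.1 hx) (not_lt_bot (a := ENNReal.ofReal r))
  simp [this, μ.map_bot']

end ContinuousValuation

/-! Approximation of lower semicontinuous functions by step functions. -/

/-- The sum of those `u` for which `(k + 1) u < t`, with `k < n`. -/
noncomputable def stepSum (u : ℝ≥0) (n : ℕ) (t : ℝ≥0∞) : ℝ≥0∞ :=
  ∑ k ∈ Finset.range n, if (((k + 1 : ℕ) * u : ℝ≥0) : ℝ≥0∞) < t then (u : ℝ≥0∞) else 0

theorem stepSum_mono {u : ℝ≥0} {m n : ℕ} (h : m ≤ n) (t : ℝ≥0∞) :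
    stepSum u m t ≤ stepSum u n t :=
  Finset.sum_le_sum_of_subset (Finset.range_mono h)

theorem stepSum_le (u : ℝ≥0) (n : ℕ) (t : ℝ≥0∞) :
    stepSum u n t ≤ ((n * u : ℝ≥0) : ℝ≥0∞) ∧ stepSum u n t ≤ t := by
  induction n with
  | zero => simp [stepSum]
  | succ n ih =>
    have hs : stepSum u (n + 1) t = stepSum u n t +
      if (((n + 1 : ℕ) * u : ℝ≥0) : ℝ≥0∞) < t then (u : ℝ≥0∞) else 0 := Finset.sum_range_succ _ _
    have he : (((n + 1 : ℕ) * u : ℝ≥0) : ℝ≥0∞) = ((n * u : ℝ≥0) : ℝ≥0∞) + u := by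
      push_cast; ring
    rw [hs]
    split_ifs with h
    · have : stepSum u n t + u ≤ (((n + 1 : ℕ) * u : ℝ≥0) : ℝ≥0∞) := by
        rw [he]; gcongr; exact ih.1
      exact ⟨this, this.trans h.le⟩
    · rw [add_zero]
      exact ⟨ih.1.trans (he ▸ le_self_add), ih.2⟩

theorem le_stepSum {u : ℝ≥0} {m n : ℕ} {t : ℝ≥0∞} (hmn : m ≤ n)
    (h : ((m * u : ℝ≥0) : ℝ≥0∞) < t) : ((m * u : ℝ≥0) : ℝ≥0∞) ≤ stepSum u n t := by
  refine le_trans (le_of_eq ?_) (stepSum_mono hmn t)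
  unfold stepSum
  rw [Finset.sum_congr rfl (g := fun _ => (u : ℝ≥0∞))]
  · simp
  · intro k hk
    refine if_pos (lt_of_le_of_lt ?_ h)
    have hk' : k + 1 ≤ m := Finset.mem_range.1 hk
    gcongr

theorem stepSum_double (u : ℝ≥0) (n : ℕ) (t : ℝ≥0∞) :
    stepSum u n t ≤ stepSum (u / 2) (2 * n) t := by
  induction n with
  | zero => simp [stepSum]
  | succ n ih =>
    have e : 2 * (n + 1) = 2 * n + 1 + 1 := by ring
    have h1 : ((n + 1 : ℕ) * u : ℝ≥0) = ((2 * n + 1 + 1 : ℕ) * (u / 2) : ℝ≥0) := by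
      push_cast; field_simp; ring
    have h2 : ((2 * n + 1 : ℕ) * (u / 2) : ℝ≥0) ≤ ((2 * n + 1 + 1 : ℕ) * (u / 2) : ℝ≥0) := by
      gcongr; omega
    unfold stepSum at ih ⊢
    rw [e, Finset.sum_range_succ, Finset.sum_range_succ, Finset.sum_range_succ, add_assoc]
    refine add_le_add ih ?_
    rw [h1]
    split_ifs with ha hb
    · rw [← ENNReal.coe_add, add_halves]
    · exact absurd (lt_of_le_of_lt (ENNReal.coe_le_coe.2 h2) ha) hb
    · exact zero_le
    · exact zero_le

theorem stepSum_monotone (t : ℝ≥0∞) : Monotone fun N : ℕ => stepSum ((1 / 2) ^ N) (4 ^ N) t := by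
  refine monotone_nat_of_le_succ fun N => (stepSum_double _ _ t).trans ?_
  have : ((1 / 2 : ℝ≥0)) ^ N / 2 = (1 / 2) ^ (N + 1) := by rw [pow_succ]; ring
  rw [this]
  refine stepSum_mono ?_ t
  rw [pow_succ]
  have := Nat.zero_le (4 ^ N)
  omega

theorem iSup_stepSum (t : ℝ≥0∞) : ⨆ N : ℕ, stepSum ((1 / 2) ^ N) (4 ^ N) t = t := by
  refine le_antisymm (iSup_le fun N => (stepSum_le _ _ t).2) ?_
  refine ENNReal.le_of_forall_nnreal_lt fun r hr => ?_
  obtain ⟨s, hrs, hst⟩ := ENNReal.lt_iff_exists_nnreal_btwn.1 hr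
  have hrs' : r < s := ENNReal.coe_lt_coe.1 hrs
  obtain ⟨N₁, hN₁⟩ := exists_pow_lt_of_lt_one (tsub_pos_of_lt hrs') (by norm_num : (1 / 2 : ℝ≥0) < 1)
  obtain ⟨N₂, hN₂⟩ := pow_unbounded_of_one_lt (r + 1) (by norm_num : (1 : ℝ≥0) < 2)
  let N := max N₁ N₂
  have hu : ((1 / 2 : ℝ≥0)) ^ N < s - r :=
    lt_of_le_of_lt (pow_le_pow_of_le_one zero_le (by norm_num) (le_max_left _ _)) hN₁
  have hw : r + 1 ≤ (2 : ℝ≥0) ^ N := hN₂.le.trans (pow_le_pow_right₀ (by norm_num) (le_max_right _ _))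
  have hinv : (2 : ℝ≥0) ^ N * (1 / 2) ^ N = 1 := by rw [← mul_pow]; norm_num
  let m := ⌊r * 2 ^ N⌋₊ + 1
  have hm1 : (m : ℝ≥0) ≤ r * 2 ^ N + 1 := by
    simp only [m]; push_cast; gcongr; exact Nat.floor_le zero_le
  have hm2 : r * 2 ^ N ≤ m := by
    simp only [m]; push_cast; exact (Nat.lt_floor_add_one _).le
  have hm4 : m ≤ 4 ^ N := by
    have : (m : ℝ≥0) ≤ ((4 ^ N : ℕ) : ℝ≥0) := by
      have h4 : ((4 ^ N : ℕ) : ℝ≥0) = 2 ^ N * 2 ^ N := by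
        push_cast; rw [← mul_pow]; norm_num
      rw [h4]
      calc (m : ℝ≥0) ≤ r * 2 ^ N + 1 := hm1
        _ ≤ r * 2 ^ N + 1 * 2 ^ N := by
          gcongr; rw [one_mul]; exact one_le_pow₀ (by norm_num)
        _ = (r + 1) * 2 ^ N := by ring
        _ ≤ 2 ^ N * 2 ^ N := by gcongr
    exact_mod_cast this
  have hlow : r ≤ m * (1 / 2) ^ N := by
    calc r = r * 2 ^ N * (1 / 2) ^ N := by rw [mul_assoc, hinv, mul_one]
      _ ≤ m * (1 / 2) ^ N := by gcongr
  have hup : (m : ℝ≥0) * (1 / 2) ^ N < s := by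
    calc (m : ℝ≥0) * (1 / 2) ^ N ≤ (r * 2 ^ N + 1) * (1 / 2) ^ N := by gcongr
      _ = r + (1 / 2) ^ N := by rw [add_mul, mul_assoc, hinv, mul_one, one_mul]
      _ < r + (s - r) := by gcongr
      _ = s := add_tsub_cancel_of_le hrs'.le
  refine le_iSup_of_le N (le_trans (ENNReal.coe_le_coe.2 hlow) (le_stepSum hm4 ?_))
  exact lt_trans (ENNReal.coe_lt_coe.2 hup) hst

namespace LSC

variable {X Y : Type u} [TopologicalSpace X] [TopologicalSpace Y]

/-- The `k`-th level set at mesh `2⁻ᴺ`. -/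
noncomputable def dyadicLevel (h : LSC X) (N k : ℕ) : Opens X :=
  h.level (((k + 1 : ℕ) * (1 / 2) ^ N : ℝ≥0) : ℝ≥0∞)

theorem addSteps_dyadic (f h : LSC X) (N : ℕ) (x : X) :
    f.addSteps ((1 / 2) ^ N) (h.dyadicLevel N) (4 ^ N) x
      = f x + stepSum ((1 / 2) ^ N) (4 ^ N) (h x) := by
  classical
  rw [addSteps_apply]
  congr 1
  refine Finset.sum_congr rfl fun k _ => ?_
  exact (Set.indicator_apply (h.dyadicLevel N k : Set X) (fun _ => (((1 / 2) ^ N : ℝ≥0) : ℝ≥0∞)) x).trans (if_congr Iff.rfl rfl rfl)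

end LSC

namespace ContinuousValuation

variable {X Y : Type u} [TopologicalSpace X] [TopologicalSpace Y]

/-- The lower dyadic sums of the integral. -/
noncomputable def dyadicSum (μ : ContinuousValuation X) (h : LSC X) (N : ℕ) : ℝ≥0∞ :=
  ∑ k ∈ Finset.range (4 ^ N), (((1 / 2) ^ N : ℝ≥0) : ℝ≥0∞) * μ (h.dyadicLevel N k)

theorem integral_add_eq_iSup (μ : ContinuousValuation X) (f h : LSC X) :
    μ.integral (f.add h) = ⨆ N, (μ.integral f + μ.dyadicSum h N) := by
  rw [μ.integral_iSup_nat (fun N => f.addSteps ((1 / 2) ^ N) (h.dyadicLevel N) (4 ^ N))]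
  · exact iSup_congr fun N => μ.integral_addSteps _ _ _ _
  · intro x N M hNM
    simp only [LSC.addSteps_dyadic]
    gcongr
    exact stepSum_monotone (h x) hNM
  · intro x
    simp only [LSC.addSteps_dyadic]
    rw [← ENNReal.add_iSup, iSup_stepSum]
    rfl

theorem dyadicSum_monotone (μ : ContinuousValuation X) (h : LSC X) :
    Monotone (μ.dyadicSum h) := by
  intro N M hNM
  have e : ∀ N, μ.dyadicSum h N
      = μ.integral (LSC.zero.addSteps ((1 / 2) ^ N) (h.dyadicLevel N) (4 ^ N)) := fun N => by
    rw [integral_addSteps, integral_zero, zero_add]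
    rfl
  rw [e, e]
  refine μ.integral_mono fun x => ?_
  rw [LSC.addSteps_dyadic, LSC.addSteps_dyadic]
  gcongr
  exact stepSum_monotone (h x) hNM

theorem integral_eq_iSup (μ : ContinuousValuation X) (h : LSC X) :
    μ.integral h = ⨆ N, μ.dyadicSum h N := by
  have : h = LSC.zero.add h := LSC.ext_fun fun x => (zero_add (h x)).symm
  conv_lhs => rw [this]
  rw [integral_add_eq_iSup]
  simp [integral_zero]

theorem integral_add (μ : ContinuousValuation X) (f h : LSC X) :
    μ.integral (f.add h) = μ.integral f + μ.integral h := by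
  rw [integral_add_eq_iSup, ← ENNReal.add_iSup, ← integral_eq_iSup]

theorem integral_smul_half_pow (μ : ContinuousValuation X) (N : ℕ) (f : LSC X) :
    μ.integral (f.smul ((1 / 2) ^ N)) = (((1 / 2) ^ N : ℝ≥0) : ℝ≥0∞) * μ.integral f := by
  induction N with
  | zero =>
    have : f.smul ((1 / 2) ^ 0) = f := LSC.ext_fun fun x => by simp [LSC.smul]
    rw [this]
    simp
  | succ N ih =>
    have hc : (((1 / 2) ^ N : ℝ≥0) : ℝ≥0∞)
        = (((1 / 2) ^ (N + 1) : ℝ≥0) : ℝ≥0∞) + (((1 / 2) ^ (N + 1) : ℝ≥0) : ℝ≥0∞) := by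
      rw [← ENNReal.coe_add, pow_succ, ← mul_add]
      norm_num
    have hf : f.smul ((1 / 2) ^ N) = (f.smul ((1 / 2) ^ (N + 1))).add (f.smul ((1 / 2) ^ (N + 1))) :=
      LSC.ext_fun fun x => by
        change _ * f x = _ * f x + _ * f x
        rw [hc, add_mul]
    rw [hf, integral_add, hc, add_mul, ← two_mul, ← two_mul] at ih
    exact (ENNReal.mul_right_inj (by simp) (by simp)).1 ih

theorem integral_iSup_directed (μ : ContinuousValuation X) {ι : Type*} [Nonempty ι]
    (f : ι → LSC X) (g : LSC X) (hf : Directed (fun a b : LSC X => ∀ x, a x ≤ b x) f)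
    (hg : ∀ x, g x = ⨆ i, f i x) : μ.integral g = ⨆ i, μ.integral (f i) := by
  have hlev : ∀ N k, μ (g.dyadicLevel N k) = ⨆ i, μ ((f i).dyadicLevel N k) := by
    intro N k
    rw [← map_iSup_directed]
    · congr 1
      ext x
      simp only [SetLike.mem_coe, Opens.mem_iSup, LSC.dyadicLevel, LSC.mem_level, hg, lt_iSup_iff]
    · intro i j
      obtain ⟨l, hil, hjl⟩ := hf i j
      exact ⟨l, fun x hx => lt_of_lt_of_le hx (hil x), fun x hx => lt_of_lt_of_le hx (hjl x)⟩
  rw [integral_eq_iSup]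
  simp_rw [integral_eq_iSup]
  rw [iSup_comm]
  refine iSup_congr fun N => ?_
  unfold dyadicSum
  simp_rw [hlev, ENNReal.mul_iSup]
  refine ENNReal.finsetSum_iSup fun i j => ?_
  obtain ⟨l, hil, hjl⟩ := hf i j
  refine ⟨l, fun k => ⟨?_, ?_⟩⟩
  · gcongr
    exact μ.mono fun x hx => lt_of_lt_of_le hx (hil x)
  · gcongr
    exact μ.mono fun x hx => lt_of_lt_of_le hx (hjl x)

end ContinuousValuation

namespace ContinuousValuation

variable {X Y : Type u} [TopologicalSpace X] [TopologicalSpace Y]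

/-- The weak topology, generated by the sets `[U > r] = {μ | μ U > r}`. -/
instance weakTopology : TopologicalSpace (ContinuousValuation X) :=
  generateFrom {S | ∃ (U : Opens X) (r : ℝ≥0), S = {μ | (r : ℝ≥0∞) < μ U}}

theorem isOpen_setOf_lt (U : Opens X) (r : ℝ≥0) :
    IsOpen {μ : ContinuousValuation X | (r : ℝ≥0∞) < μ U} :=
  isOpen_generateFrom_of_mem ⟨U, r, rfl⟩

/-- The lower semicontinuous function `μ ↦ μ U`. -/
def eval (U : Opens X) : LSC (ContinuousValuation X) where
  toFun μ := μ U
  lsc := by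
    rw [lowerSemicontinuous_iff_isOpen_preimage]
    intro r
    induction r with
    | top => simp
    | coe r => exact isOpen_setOf_lt U r

/-- The lower semicontinuous function `μ ↦ ∫ h dμ`. -/
noncomputable def evalIntegral (h : LSC X) : LSC (ContinuousValuation X) where
  toFun μ := μ.integral h
  lsc := by
    simp_rw [integral_eq_iSup]
    exact lowerSemicontinuous_iSup fun N => lowerSemicontinuous_sum fun k _ =>
      ((eval (h.dyadicLevel N k)).smul ((1 / 2) ^ N)).lsc

instance : T0Space (ContinuousValuation X) := by
  refine ⟨fun μ ν h => ext_apply fun U => ?_⟩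
  have key : ∀ r : ℝ≥0, (r : ℝ≥0∞) < μ U ↔ (r : ℝ≥0∞) < ν U := fun r =>
    h.mem_open_iff (isOpen_setOf_lt U r)
  exact le_antisymm (ENNReal.le_of_forall_nnreal_lt fun r hr => ((key r).1 hr).le)
    (ENNReal.le_of_forall_nnreal_lt fun r hr => ((key r).2 hr).le)

/-- The Dirac mass `δ_x`. -/
noncomputable def dirac (x : X) : ContinuousValuation X where
  toFun U := indicator (U : Set X) (fun _ => 1) x
  map_bot' := by simp
  mono' U V h := indicator_le_indicator_of_subset h (fun _ => zero_le) x
  modular' U V := by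
    classical
    by_cases hU : x ∈ U <;> by_cases hV : x ∈ V <;> simp [hU, hV]
  map_sSup' S _ _ := by
    classical
    by_cases h : x ∈ sSup S
    · obtain ⟨U, hU, hx⟩ := Opens.mem_sSup.1 h
      rw [indicator_of_mem (show x ∈ ((sSup S : Opens X) : Set X) from h)]
      refine le_antisymm ?_ (iSup₂_le fun V _ => indicator_apply_le fun _ => le_rfl)
      refine le_iSup₂_of_le U hU ?_
      rw [indicator_of_mem (show x ∈ (U : Set X) from hx)]
    · rw [indicator_of_notMem (show x ∉ ((sSup S : Opens X) : Set X) from h)]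
      refine (le_antisymm (iSup₂_le fun V hV => ?_) zero_le).symm
      rw [indicator_of_notMem]
      exact fun hx => h (Opens.mem_sSup.2 ⟨V, hV, hx⟩)

/-- The sum of two continuous valuations. -/
noncomputable instance : Add (ContinuousValuation X) where
  add μ ν :=
    { toFun := fun U => μ U + ν U
      map_bot' := by simp [map_bot']
      mono' := fun U V h => add_le_add (μ.mono h) (ν.mono h)
      modular' := fun U V => by
        rw [add_add_add_comm, μ.modular', ν.modular', add_add_add_comm]
      map_sSup' := fun S hS hd => by
        have : Nonempty S := hS.to_subtype
        rw [μ.map_sSup' S hS hd, ν.map_sSup' S hS hd, iSup_subtype', iSup_subtype', iSup_subtype']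
        refine ENNReal.iSup_add_iSup fun i j => ?_
        obtain ⟨k, hk, hik, hjk⟩ := hd i i.2 j j.2
        exact ⟨⟨k, hk⟩, add_le_add (μ.mono hik) (ν.mono hjk)⟩ }

/-- Multiplication of a continuous valuation by a nonnegative real number. -/
noncomputable instance : SMul ℝ≥0 (ContinuousValuation X) where
  smul r μ :=
    { toFun := fun U => r * μ U
      map_bot' := by simp [map_bot']
      mono' := fun U V h => by gcongr; exact μ.mono h
      modular' := fun U V => by rw [← mul_add, μ.modular', mul_add]
      map_sSup' := fun S hS hd => by
        rw [μ.map_sSup' S hS hd]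
        simp_rw [ENNReal.mul_iSup] }

theorem add_apply (μ ν : ContinuousValuation X) (U : Opens X) : (μ + ν) U = μ U + ν U := rfl

theorem smul_apply (r : ℝ≥0) (μ : ContinuousValuation X) (U : Opens X) :
    (r • μ) U = r * μ U := rfl

/-- The image valuation `V ↦ μ (f⁻¹ V)`. -/
def map (f : C(X, Y)) (μ : ContinuousValuation X) : ContinuousValuation Y where
  toFun V := μ (Opens.comap f V)
  map_bot' := μ.map_bot'
  mono' U V h := μ.mono (Opens.comap_mono f h)
  modular' U V := μ.modular' _ _
  map_sSup' S hS hd := by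
    have : Nonempty S := hS.to_subtype
    rw [sSup_eq_iSup', map_iSup, map_iSup_directed, iSup_subtype']
    intro i j
    obtain ⟨k, hk, hik, hjk⟩ := hd i i.2 j j.2
    exact ⟨⟨k, hk⟩, Opens.comap_mono f hik, Opens.comap_mono f hjk⟩

/-- The multiplication of the monad: `join ϖ U = ∫ μ U dϖ(μ)`. -/
noncomputable def join (ϖ : ContinuousValuation (ContinuousValuation X)) :
    ContinuousValuation X where
  toFun U := ϖ.integral (eval U)
  map_bot' := by
    rw [show (eval ⊥ : LSC (ContinuousValuation X)) = LSC.zero from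
      LSC.ext_fun fun μ => μ.map_bot', integral_zero]
  mono' U V h := ϖ.integral_mono fun μ => μ.mono h
  modular' U V := by
    rw [← integral_add, ← integral_add]
    congr 1
    exact LSC.ext_fun fun μ => μ.modular' U V
  map_sSup' S hS hd := by
    have : Nonempty S := hS.to_subtype
    rw [iSup_subtype']
    refine ϖ.integral_iSup_directed (fun U : S => eval U.1) (eval (sSup S)) ?_ ?_
    · intro i j
      obtain ⟨k, hk, hik, hjk⟩ := hd i i.2 j j.2
      exact ⟨⟨k, hk⟩, fun μ => μ.mono hik, fun μ => μ.mono hjk⟩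
    · intro μ
      refine (μ.map_sSup' S hS hd).trans ?_
      rw [iSup_subtype']
      rfl

theorem continuous_of_eval {f : Y → ContinuousValuation X}
    (h : ∀ U, LowerSemicontinuous fun y => f y U) : Continuous f := by
  refine continuous_generateFrom_iff.2 ?_
  rintro _ ⟨U, r, rfl⟩
  exact (h U).isOpen_preimage r

theorem continuous_dirac : Continuous (dirac : X → ContinuousValuation X) :=
  continuous_of_eval fun U => U.isOpen.lowerSemicontinuous_indicator zero_le_one

theorem continuous_map (f : C(X, Y)) : Continuous (map f) :=
  continuous_of_eval fun U => (eval (Opens.comap f U)).lsc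

theorem continuous_join : Continuous (join : _ → ContinuousValuation X) :=
  continuous_of_eval fun U => (evalIntegral (eval U)).lsc

theorem integral_map (f : C(X, Y)) (μ : ContinuousValuation X) (h : LSC Y) :
    (map f μ).integral h = μ.integral (h.comp f) := rfl

theorem integral_dirac (x : X) (h : LSC X) : (dirac x).integral h = h x := by
  rw [integral_eq_iSup]
  refine Eq.trans (iSup_congr fun N => ?_) (iSup_stepSum (h x))
  classical
  refine Finset.sum_congr rfl fun k _ => ?_
  simp only [dirac, indicator_apply, mul_ite, mul_one, mul_zero]
  exact if_congr Iff.rfl rfl rfl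

/-- The characteristic function of an open set integrates to its value. -/
theorem integral_indicator (μ : ContinuousValuation X) (U : Opens X) (h : LSC X)
    (hh : ∀ x, h x = indicator (U : Set X) (fun _ => 1) x) : μ.integral h = μ U := by
  have : h = LSC.zero.add (LSC.step 1 U) := LSC.ext_fun fun x => by
    rw [hh]
    exact (zero_add _).symm
  rw [this, integral_add_step, integral_zero]
  simp

theorem integral_join (ϖ : ContinuousValuation (ContinuousValuation X)) (h : LSC X) :
    (join ϖ).integral h = ϖ.integral (evalIntegral h) := by
  let c : ℕ → ℝ≥0 := fun N => (1 / 2) ^ N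
  let S : ℕ → ℕ → LSC (ContinuousValuation X) := fun N n =>
    n.rec LSC.zero fun k f => f.add ((eval (h.dyadicLevel N k)).smul (c N))
  have hS : ∀ N n μ, S N n μ = ∑ k ∈ Finset.range n, (c N : ℝ≥0∞) * μ (h.dyadicLevel N k) := by
    intro N n μ
    induction n with
    | zero => rfl
    | succ n ih => rw [Finset.sum_range_succ, ← ih]; rfl
  have hI : ∀ N n, ϖ.integral (S N n)
      = ∑ k ∈ Finset.range n, (c N : ℝ≥0∞) * join ϖ (h.dyadicLevel N k) := by
    intro N n
    induction n with
    | zero => exact ϖ.integral_zero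
    | succ n ih =>
      rw [Finset.sum_range_succ, ← ih]
      exact (ϖ.integral_add _ _).trans (congrArg _ (ϖ.integral_smul_half_pow N _))
  rw [ϖ.integral_iSup_nat (fun N => S N (4 ^ N)), integral_eq_iSup]
  · exact iSup_congr fun N => (hI N (4 ^ N)).symm
  · intro μ N M hNM
    simp only [hS]
    exact μ.dyadicSum_monotone h hNM
  · intro μ
    simp only [hS]
    exact μ.integral_eq_iSup h

end ContinuousValuation

section Monad

open CategoryTheory

/-- The category `TOP₀` of `T₀` topological spaces and continuous maps. -/
abbrev TopCat₀ : Type (u + 1) :=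
  ObjectProperty.FullSubcategory fun X : TopCat.{u} => T0Space X

/-- A `T₀` space as an object of `TOP₀`. -/
abbrev TopCat₀.of (X : Type u) [TopologicalSpace X] [T0Space X] : TopCat₀.{u} :=
  ⟨TopCat.of X, inferInstanceAs (T0Space X)⟩

/-- A continuous map as a morphism of `TOP₀`. -/
abbrev TopCat₀.ofHom {X Y : TopCat₀.{u}} (f : C(X.obj, Y.obj)) : X ⟶ Y :=
  ObjectProperty.homMk (TopCat.ofHom f)

/-- The endofunctor `V_w`. -/
noncomputable def valuationFunctor : TopCat₀.{u} ⥤ TopCat₀.{u} where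
  obj X := TopCat₀.of (ContinuousValuation X.obj)
  map f := TopCat₀.ofHom
    ⟨ContinuousValuation.map f.hom.hom, ContinuousValuation.continuous_map f.hom.hom⟩
  map_id _ := rfl
  map_comp _ _ := rfl

/-- The extended probabilistic powerdomain monad `V_w` on `TOP₀`. -/
noncomputable def valuationMonad : Monad TopCat₀.{u} where
  toFunctor := valuationFunctor
  η :=
    { app := fun X => TopCat₀.ofHom
        ⟨ContinuousValuation.dirac, ContinuousValuation.continuous_dirac⟩
      naturality := fun _ _ _ => rfl }
  μ :=
    { app := fun X => TopCat₀.ofHom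
        ⟨ContinuousValuation.join, ContinuousValuation.continuous_join⟩
      naturality := fun _ _ _ => rfl }
  assoc X := by
    apply ObjectProperty.hom_ext
    ext ξ
    refine ContinuousValuation.ext_apply fun U => ?_
    exact (ContinuousValuation.integral_join ξ (ContinuousValuation.eval U)).symm
  left_unit X := by
    apply ObjectProperty.hom_ext
    ext ν
    refine ContinuousValuation.ext_apply fun U => ?_
    exact ContinuousValuation.integral_dirac ν (ContinuousValuation.eval U)
  right_unit X := by
    apply ObjectProperty.hom_ext
    ext ν
    refine ContinuousValuation.ext_apply fun U => ?_
    exact ν.integral_indicator U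
      ((ContinuousValuation.eval U).comp
        ⟨ContinuousValuation.dirac, ContinuousValuation.continuous_dirac⟩) fun _ => rfl

end Monad

/-- A semitopological cone: a cone (that is, an `ℝ≥0`-module) with a `T₀` topology for which
addition and scalar multiplication are separately continuous, where the scalars carry the Scott
topology. -/
class SemitopologicalCone (C : Type u) [TopologicalSpace C] [AddCommMonoid C] [Module ℝ≥0 C] :
    Prop extends T0Space C where
  continuous_const_add : ∀ x : C, Continuous fun y : C => x + y
  continuous_add_const : ∀ y : C, Continuous fun x : C => x + y
  continuous_const_smul : ∀ r : ℝ≥0, Continuous fun x : C => r • x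
  continuous_smul_const : ∀ x : C,
    Continuous fun r : Topology.WithScott ℝ≥0 => Topology.WithScott.ofScott r • x

/-- A topological cone: a cone with a `T₀` topology for which addition and scalar multiplication
are jointly continuous, where the scalars carry the Scott topology. -/
class TopologicalCone (C : Type u) [TopologicalSpace C] [AddCommMonoid C] [Module ℝ≥0 C] :
    Prop extends T0Space C where
  continuous_add : Continuous fun p : C × C => p.1 + p.2
  continuous_smul :
    Continuous fun p : Topology.WithScott ℝ≥0 × C => Topology.WithScott.ofScott p.1 • p.2

/-- Weak local convexity: every open neighbourhood of a point contains a convex (not necessarily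
open) neighbourhood of that point. -/
def WeaklyLocallyConvex (C : Type u) [TopologicalSpace C] [AddCommMonoid C] [Module ℝ≥0 C] :
    Prop :=
  ∀ (x : C) (U : Set C), IsOpen U → x ∈ U → ∃ K ∈ nhds x, Convex ℝ≥0 K ∧ K ⊆ U

/-- A sober space: a `T₀` space in which every irreducible closed set has a generic point. -/
def IsSober (X : Type u) [TopologicalSpace X] : Prop := T0Space X ∧ QuasiSober X

/-- `b` is a barycentre of `ν`: for every lower semicontinuous linear `Λ : C → [0, ∞]`,
`Λ b = ∫ Λ dν`. -/
def IsBarycentre {C : Type u} [TopologicalSpace C] [AddCommMonoid C] [Module ℝ≥0 C]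
    (ν : ContinuousValuation C) (b : C) : Prop :=
  ∀ (Λ : C →ₗ[ℝ≥0] ℝ≥0∞) (hΛ : LowerSemicontinuous Λ), Λ b = ν.integral ⟨Λ, hΛ⟩

/-- `α` is the structure map of an Eilenberg-Moore algebra with carrier `X` of the monad `V_w`. -/
def IsValuationAlgebra {X : Type u} [TopologicalSpace X] [T0Space X]
    (α : C(ContinuousValuation X, X)) : Prop :=
  ∃ A : valuationMonad.{u}.Algebra, A.A = TopCat₀.of X ∧
    A.a ≍ (TopCat₀.ofHom α : TopCat₀.of (ContinuousValuation X) ⟶ TopCat₀.of X)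

/-- The addition induced by a structure map. -/
noncomputable def inducedAdd {X : Type u} [TopologicalSpace X]
    (α : C(ContinuousValuation X, X)) (x y : X) : X :=
  α (ContinuousValuation.dirac x + ContinuousValuation.dirac y)

/-- The scalar multiplication induced by a structure map. -/
noncomputable def inducedSMul {X : Type u} [TopologicalSpace X]
    (α : C(ContinuousValuation X, X)) (r : ℝ≥0) (x : X) : X :=
  α (r • ContinuousValuation.dirac x)

/-!
A barycentre map `α` is linear and satisfies `α δ_x = x`, because `μ ↦ ∫ Λ dμ` is linear and sends
`δ_x` to `Λ x` for every lower semicontinuous linear `Λ`, and barycentres are unique. Hence `C` is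
a retract of `𝒱_w C` by a continuous linear map, whose continuous section `x ↦ δ_x` is not linear.
The space `𝒱_w C` is itself a sober, weakly locally convex, topological cone, and all of these
properties pass to such a retract; for instance, `x + y = α (δ_x + δ_y)` is jointly continuous.

For sobriety of `𝒱_w X`, the generic point of an irreducible closed set `S` of valuations is the
pointwise supremum of `S`: irreducibility replaces the directedness that would normally be needed
for a pointwise supremum of modular maps to be modular.
-/

theorem lowerSemicontinuous_ennreal_mul {X : Type*} [TopologicalSpace X] {f g : X → ℝ≥0∞}
    (hf : LowerSemicontinuous f) (hg : LowerSemicontinuous g) :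
    LowerSemicontinuous fun x => f x * g x := by
  simp only [lowerSemicontinuous_iff_le_liminf] at hf hg ⊢
  exact fun x => (mul_le_mul' (hf x) (hg x)).trans ENNReal.le_liminf_mul

theorem lowerSemicontinuous_ofScott :
    LowerSemicontinuous fun r : Topology.WithScott ℝ≥0 =>
      ((Topology.WithScott.ofScott r : ℝ≥0) : ℝ≥0∞) := by
  rw [lowerSemicontinuous_iff_isOpen_preimage]
  rintro (_ | c)
  · simp
  · have hclosed : IsClosed (closure {Topology.WithScott.toScott c}) := isClosed_closure
    rw [Topology.IsScott.closure_singleton] at hclosed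
    convert hclosed.isOpen_compl using 1
    ext r
    exact ENNReal.coe_lt_coe.trans not_le.symm

theorem biSup_add_biSup_of_isPreirreducible {X : Type*} [TopologicalSpace X] {S : Set X}
    (hS : IsPreirreducible S) {f g : X → ℝ≥0∞} (hf : LowerSemicontinuous f)
    (hg : LowerSemicontinuous g) :
    (⨆ x ∈ S, f x) + (⨆ x ∈ S, g x) = ⨆ x ∈ S, (f x + g x) := by
  refine le_antisymm ?_
    (iSup₂_le fun x hx => add_le_add (le_iSup₂_of_le x hx le_rfl) (le_iSup₂_of_le x hx le_rfl))
  obtain rfl | hne := S.eq_empty_or_nonempty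
  · simp
  refine ENNReal.biSup_add_biSup_le hne hne fun x hx y hy => ?_
  obtain hfx | hfx := eq_or_ne (f x) 0
  · exact le_iSup₂_of_le y hy (by simp [hfx])
  obtain hgy | hgy := eq_or_ne (g y) 0
  · exact le_iSup₂_of_le x hx (by simp [hgy])
  refine le_of_forall_lt fun c hc => ?_
  obtain ⟨a, ha, b, hb, hab⟩ := ENNReal.exists_lt_add_of_lt_add hc hfx hgy
  obtain ⟨z, hz, haz, hbz⟩ :=
    hS _ _ (hf.isOpen_preimage a) (hg.isOpen_preimage b) ⟨x, hx, ha⟩ ⟨y, hy, hb⟩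
  exact (hab.trans (ENNReal.add_lt_add haz hbz)).trans_le (le_iSup₂_of_le z hz le_rfl)

theorem WeaklyLocallyConvex.of_eq_generateFrom {C : Type u} [t : TopologicalSpace C]
    [AddCommMonoid C] [Module ℝ≥0 C] {B : Set (Set C)} (hB : t = generateFrom B)
    (hconvex : ∀ s ∈ B, Convex ℝ≥0 s) : WeaklyLocallyConvex C := by
  intro x U hU hx
  have hbasis := isTopologicalBasis_of_subbasis hB
  obtain ⟨_, ⟨F, hF, rfl⟩, hxF, hFU⟩ := hbasis.exists_subset_of_mem_open hx hU
  exact ⟨⋂₀ F, (hbasis.isOpen ⟨F, hF, rfl⟩).mem_nhds hxF,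
    convex_sInter fun s hs => hconvex s (hF.2 hs), hFU⟩

theorem mem_closure_of_isIrreducible_of_eq_generateFrom {X : Type*} [t : TopologicalSpace X]
    {B : Set (Set X)} (hB : t = generateFrom B) {S : Set X} (hS : IsIrreducible S) {x : X}
    (h : ∀ s ∈ B, x ∈ s → (S ∩ s).Nonempty) : x ∈ closure S := by
  rw [(isTopologicalBasis_of_subbasis hB).mem_closure_iff]
  rintro _ ⟨F, ⟨hF, hFB⟩, rfl⟩ hx
  rw [inter_comm, ← hF.coe_toFinset]
  refine isIrreducible_iff_sInter.1 hS hF.toFinset (fun s hs => ?_) fun s hs => ?_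
  · rw [hB]
    exact isOpen_generateFrom_of_mem (hFB (hF.mem_toFinset.1 hs))
  · exact h s (hFB (hF.mem_toFinset.1 hs)) (hx s (hF.mem_toFinset.1 hs))

section Retract

variable {E C : Type*} [TopologicalSpace E] [TopologicalSpace C] {f : E → C} {s : C → E}

theorem quasiSober_of_leftInverse [QuasiSober E] (hf : Continuous f) (hs : Continuous s)
    (hfs : Function.LeftInverse f s) : QuasiSober C where
  sober {S} hS hclosed := by
    obtain ⟨e, he⟩ := QuasiSober.sober (hS.image s hs.continuousOn).closure isClosed_closure
    have hfe : IsGenericPoint (f e) (closure (f '' closure (s '' S))) := he.image hf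
    rw [closure_image_closure hf, hfs.image_image, hclosed.closure_eq] at hfe
    exact ⟨f e, hfe⟩

theorem IsSober.of_leftInverse (hE : IsSober E) (hf : Continuous f) (hs : Continuous s)
    (hfs : Function.LeftInverse f s) : IsSober C :=
  have := hE.1
  have := hE.2
  ⟨t0Space_of_injective_of_continuous hfs.injective hs, quasiSober_of_leftInverse hf hs hfs⟩

end Retract

section LinearRetract

variable {E C : Type u} [TopologicalSpace E] [AddCommMonoid E] [Module ℝ≥0 E]
  [TopologicalSpace C] [AddCommMonoid C] [Module ℝ≥0 C]
  {f : E →L[ℝ≥0] C} {s : C → E}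

theorem WeaklyLocallyConvex.of_leftInverse (hE : WeaklyLocallyConvex E) (hs : Continuous s)
    (hfs : Function.LeftInverse f s) : WeaklyLocallyConvex C := by
  intro x U hU hx
  have hfsx : s x ∈ f ⁻¹' U := by rwa [mem_preimage, hfs x]
  obtain ⟨K, hK, hconvex, hKU⟩ := hE (s x) (f ⁻¹' U) (hU.preimage f.continuous) hfsx
  refine ⟨f '' K, ?_, hconvex.is_linear_image f.toLinearMap.isLinear, image_subset_iff.2 hKU⟩
  filter_upwards [hs.continuousAt hK] with y hy using ⟨s y, hy, hfs y⟩

theorem TopologicalCone.of_leftInverse [TopologicalCone E] (hs : Continuous s)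
    (hfs : Function.LeftInverse f s) : TopologicalCone C where
  toT0Space := t0Space_of_injective_of_continuous hfs.injective hs
  continuous_add := by
    have h : Continuous fun p : C × C => f (s p.1 + s p.2) :=
      f.continuous.comp (TopologicalCone.continuous_add.comp (hs.prodMap hs))
    simpa only [map_add, hfs _] using h
  continuous_smul := by
    have h : Continuous fun p : Topology.WithScott ℝ≥0 × C =>
        f (Topology.WithScott.ofScott p.1 • s p.2) :=
      f.continuous.comp (TopologicalCone.continuous_smul.comp (continuous_id.prodMap hs))
    simpa only [map_smul, hfs _] using h

end LinearRetract

namespace ContinuousValuation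

variable {X : Type u} [TopologicalSpace X]

instance : Zero (ContinuousValuation X) where
  zero :=
    { toFun := fun _ => 0
      map_bot' := rfl
      mono' := fun _ _ _ => le_rfl
      modular' := fun _ _ => rfl
      map_sSup' := fun _ _ _ => by simp }

theorem zero_apply (U : Opens X) : (0 : ContinuousValuation X) U = 0 := rfl

noncomputable instance : AddCommMonoid (ContinuousValuation X) where
  add_assoc _ _ _ := ext_apply fun _ => add_assoc _ _ _
  zero_add _ := ext_apply fun _ => zero_add _
  add_zero _ := ext_apply fun _ => add_zero _
  add_comm _ _ := ext_apply fun _ => add_comm _ _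
  nsmul := nsmulRec

noncomputable instance : Module ℝ≥0 (ContinuousValuation X) where
  one_smul μ := ext_apply fun U => by simp only [smul_apply, ENNReal.coe_one, one_mul]
  mul_smul r s μ := ext_apply fun U => by simp only [smul_apply, ENNReal.coe_mul, mul_assoc]
  smul_zero r := ext_apply fun U => by simp only [smul_apply, zero_apply, mul_zero]
  smul_add r μ ν := ext_apply fun U => by simp only [smul_apply, add_apply, mul_add]
  add_smul r s μ := ext_apply fun U => by
    simp only [smul_apply, add_apply, ENNReal.coe_add, add_mul]
  zero_smul μ := ext_apply fun U => by
    simp only [smul_apply, zero_apply, ENNReal.coe_zero, zero_mul]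

instance : TopologicalCone (ContinuousValuation X) where
  continuous_add := continuous_of_eval fun U =>
    ((eval U).lsc.comp continuous_fst).add ((eval U).lsc.comp continuous_snd)
  continuous_smul := continuous_of_eval fun U =>
    lowerSemicontinuous_ennreal_mul (lowerSemicontinuous_ofScott.comp continuous_fst)
      ((eval U).lsc.comp continuous_snd)

theorem convex_setOf_lt (U : Opens X) (r : ℝ≥0∞) :
    Convex ℝ≥0 {μ : ContinuousValuation X | r < μ U} := by
  intro μ hμ ν hν a b _ _ hab
  calc r < min (μ U) (ν U) := lt_min hμ hν
    _ = a * min (μ U) (ν U) + b * min (μ U) (ν U) := by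
      rw [← add_mul, ← ENNReal.coe_add, hab, ENNReal.coe_one, one_mul]
    _ ≤ a * μ U + b * ν U := by
      gcongr
      exacts [min_le_left _ _, min_le_right _ _]

theorem weaklyLocallyConvex : WeaklyLocallyConvex (ContinuousValuation X) :=
  .of_eq_generateFrom rfl <| by
    rintro _ ⟨U, r, rfl⟩
    exact convex_setOf_lt U r

theorem specializes_of_le {μ ν : ContinuousValuation X} (h : ∀ U, μ U ≤ ν U) : ν ⤳ μ := by
  rw [specializes_iff_pure, nhds_generateFrom]
  simp only [le_iInf_iff, Filter.le_principal_iff, Filter.mem_pure]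
  rintro _ ⟨hμ, U, r, rfl⟩
  exact lt_of_lt_of_le hμ (h U)

/-- The pointwise supremum of a preirreducible set of valuations; when the set is irreducible, this
is the generic point of its closure. -/
noncomputable def pointwiseSup {S : Set (ContinuousValuation X)} (hS : IsPreirreducible S) :
    ContinuousValuation X where
  toFun U := ⨆ μ ∈ S, μ U
  map_bot' := by simp [map_bot']
  mono' _ _ h := iSup₂_mono fun μ _ => μ.mono h
  modular' U V := by
    have hadd (U V : Opens X) :=
      biSup_add_biSup_of_isPreirreducible hS (eval U).lsc (eval V).lsc
    refine (hadd U V).trans (Eq.trans ?_ (hadd (U ⊔ V) (U ⊓ V)).symm)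
    exact iSup_congr fun μ => iSup_congr fun _ => μ.modular' U V
  map_sSup' T hT hdir := by
    simp_rw [fun μ : ContinuousValuation X => μ.map_sSup' T hT hdir]
    exact iSup₂_comm _

theorem le_pointwiseSup {S : Set (ContinuousValuation X)} (hS : IsPreirreducible S)
    {μ : ContinuousValuation X} (hμ : μ ∈ S) (U : Opens X) : μ U ≤ pointwiseSup hS U :=
  le_biSup (fun ν : ContinuousValuation X => ν U) hμ

theorem isGenericPoint_pointwiseSup {S : Set (ContinuousValuation X)} (hS : IsIrreducible S) :
    IsGenericPoint (pointwiseSup hS.isPreirreducible) (closure S) := by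
  refine subset_antisymm (closure_minimal (singleton_subset_iff.2 ?_) isClosed_closure)
    (closure_minimal (fun μ hμ => ?_) isClosed_closure)
  · refine mem_closure_of_isIrreducible_of_eq_generateFrom rfl hS ?_
    rintro _ ⟨U, r, rfl⟩ hr
    have hr' : (r : ℝ≥0∞) < ⨆ μ ∈ S, (μ : ContinuousValuation X) U := hr
    obtain ⟨μ, hμ, hrμ⟩ := lt_biSup_iff.1 hr'
    exact ⟨μ, hμ, hrμ⟩
  · exact (specializes_of_le fun U => le_pointwiseSup hS.isPreirreducible hμ U).mem_closure

theorem isSober : IsSober (ContinuousValuation X) where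
  left := inferInstance
  right := ⟨fun hS hclosed => ⟨_, hclosed.closure_eq ▸ isGenericPoint_pointwiseSup hS⟩⟩

theorem integral_add_valuation (μ ν : ContinuousValuation X) (h : LSC X) :
    (μ + ν).integral h = μ.integral h + ν.integral h :=
  lintegral_add_left (μ.antitone_level h).measurable _

theorem integral_smul_valuation (r : ℝ≥0) (μ : ContinuousValuation X) (h : LSC X) :
    (r • μ).integral h = r * μ.integral h :=
  lintegral_const_mul _ (μ.antitone_level h).measurable

end ContinuousValuation

theorem isValuationAlgebra_of_apply_dirac_of_apply_join {X : Type u} [TopologicalSpace X]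
    [T0Space X] {α : C(ContinuousValuation X, X)}
    (hdirac : ∀ x, α (ContinuousValuation.dirac x) = x)
    (hjoin : ∀ ϖ : ContinuousValuation (ContinuousValuation X), α ϖ.join = α (ϖ.map α)) :
    IsValuationAlgebra α := by
  refine ⟨{ A := TopCat₀.of X, a := TopCat₀.ofHom α, unit := ?_, assoc := ?_ }, rfl, HEq.rfl⟩
  · apply CategoryTheory.ObjectProperty.hom_ext
    ext x
    exact hdirac x
  · apply CategoryTheory.ObjectProperty.hom_ext
    ext ϖ
    exact hjoin ϖ

section Barycentre

variable {C : Type u} [TopologicalSpace C] [AddCommMonoid C] [Module ℝ≥0 C]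

namespace IsBarycentre

theorem dirac (x : C) : IsBarycentre (ContinuousValuation.dirac x) x := fun Λ hΛ =>
  (ContinuousValuation.integral_dirac x ⟨Λ, hΛ⟩).symm

theorem add {μ ν : ContinuousValuation C} {b c : C} (hb : IsBarycentre μ b)
    (hc : IsBarycentre ν c) : IsBarycentre (μ + ν) (b + c) := fun Λ hΛ => by
  rw [map_add, ContinuousValuation.integral_add_valuation, hb Λ hΛ, hc Λ hΛ]

theorem smul {μ : ContinuousValuation C} {b : C} (r : ℝ≥0) (hb : IsBarycentre μ b) :
    IsBarycentre (r • μ) (r • b) := fun Λ hΛ => by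
  rw [map_smul, ContinuousValuation.integral_smul_valuation, hb Λ hΛ, ENNReal.smul_def,
    smul_eq_mul]

theorem join {α : C(ContinuousValuation C, C)} (hα : ∀ ν, IsBarycentre ν (α ν))
    {ϖ : ContinuousValuation (ContinuousValuation C)} {b : C}
    (hb : IsBarycentre (ϖ.map α) b) : IsBarycentre ϖ.join b := fun Λ hΛ => by
  have hcomp : (⟨Λ, hΛ⟩ : LSC C).comp α = ContinuousValuation.evalIntegral ⟨Λ, hΛ⟩ :=
    LSC.ext_fun fun ν => hα ν Λ hΛ
  rw [hb Λ hΛ, ContinuousValuation.integral_join, ContinuousValuation.integral_map, hcomp]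

end IsBarycentre

/-- A barycentre map sends every continuous valuation to its unique barycentre. -/
def IsBarycentreMap (α : ContinuousValuation C → C) : Prop :=
  ∀ ν, IsBarycentre ν (α ν) ∧ ∀ b, IsBarycentre ν b → b = α ν

namespace IsBarycentreMap

section Algebraic

variable {α : ContinuousValuation C → C}

theorem apply_dirac (hα : IsBarycentreMap α) (x : C) :
    α (ContinuousValuation.dirac x) = x :=
  ((hα _).2 x (.dirac x)).symm

theorem map_add (hα : IsBarycentreMap α) (μ ν : ContinuousValuation C) :
    α (μ + ν) = α μ + α ν :=
  ((hα _).2 _ ((hα μ).1.add (hα ν).1)).symm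

theorem map_smul (hα : IsBarycentreMap α) (r : ℝ≥0) (μ : ContinuousValuation C) :
    α (r • μ) = r • α μ :=
  ((hα _).2 _ ((hα μ).1.smul r)).symm

end Algebraic

variable {α : C(ContinuousValuation C, C)}

theorem apply_join (hα : IsBarycentreMap α)
    (ϖ : ContinuousValuation (ContinuousValuation C)) : α ϖ.join = α (ϖ.map α) :=
  ((hα _).2 _ (.join (fun ν => (hα ν).1) (hα _).1)).symm

theorem inducedAdd_eq_add (hα : IsBarycentreMap α) (x y : C) : inducedAdd α x y = x + y := by
  rw [inducedAdd, hα.map_add, hα.apply_dirac, hα.apply_dirac]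

theorem inducedSMul_eq_smul (hα : IsBarycentreMap α) (r : ℝ≥0) (x : C) :
    inducedSMul α r x = r • x := by
  rw [inducedSMul, hα.map_smul, hα.apply_dirac]

/-- A continuous barycentre map, bundled as a continuous linear map. -/
def toContinuousLinearMap (hα : IsBarycentreMap α) : ContinuousValuation C →L[ℝ≥0] C where
  toFun := α
  map_add' := hα.map_add
  map_smul' := hα.map_smul
  cont := α.continuous

theorem leftInverse_dirac (hα : IsBarycentreMap α) :
    Function.LeftInverse hα.toContinuousLinearMap ContinuousValuation.dirac :=
  hα.apply_dirac

end IsBarycentreMap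

end Barycentre

theorem mainTheorem3_general {C : Type u} [TopologicalSpace C] [AddCommMonoid C] [Module ℝ≥0 C]
    {α : C(ContinuousValuation C, C)} (hα : IsBarycentreMap α) :
    ∃ _ : T0Space C, IsValuationAlgebra α ∧
      (∀ x y : C, inducedAdd α x y = x + y) ∧
      (∀ (r : ℝ≥0) (x : C), inducedSMul α r x = r • x) ∧
      IsSober C ∧ WeaklyLocallyConvex C ∧ TopologicalCone C := by
  have hdirac : Continuous (ContinuousValuation.dirac : C → _) :=
    ContinuousValuation.continuous_dirac
  have hretract := hα.leftInverse_dirac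
  have hsober : IsSober C :=
    ContinuousValuation.isSober.of_leftInverse α.continuous hdirac hretract
  have := hsober.1
  exact ⟨hsober.1,
    isValuationAlgebra_of_apply_dirac_of_apply_join hα.apply_dirac hα.apply_join,
    hα.inducedAdd_eq_add, hα.inducedSMul_eq_smul, hsober,
    ContinuousValuation.weaklyLocallyConvex.of_leftInverse hdirac hretract,
    .of_leftInverse hdirac hretract⟩

theorem mainTheorem3 (C : Type u) [TopologicalSpace C] [AddCommMonoid C] [Module ℝ≥0 C]
    [SemitopologicalCone C] (α : C(ContinuousValuation C, C))
    (hα : ∀ ν : ContinuousValuation C,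
      IsBarycentre ν (α ν) ∧ ∀ b : C, IsBarycentre ν b → b = α ν) :
    IsValuationAlgebra α ∧
    (∀ x y : C, inducedAdd α x y = x + y) ∧
    (∀ (r : ℝ≥0) (x : C), inducedSMul α r x = r • x) ∧
    IsSober C ∧ WeaklyLocallyConvex C ∧ TopologicalCone C := by
  obtain ⟨_, h⟩ := mainTheorem3_general hα
  exact h
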